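/- Let $q$ be a prime power, $r\ge 1$, and $\sigma(x)=x^q$ on $\mathbb F_{q^r}$. Let $\mathbb F_{q^r}[X,\sigma]$ be the skew polynomial ring, with multiplication determined by $X\cdot a=\sigma(a)\cdot X$. A skew polynomial $S$ is a right-divisor of $T$ if $T=US$ for some $U\in\mathbb F_{q^r}[X,\sigma]$; and $\mathrm{rgcd}(S,T)$ is the monic common right-divisor of $S$ and $T$ (not both zero) that is right-divisible by every common right-divisor of $S$ and $T$. For a monic $P=X^d-\sum_{j=0}^{d-1}a_jX^j\in\mathbb F_{q^r}[X,\sigma]$ let $D_P=\bigoplus_{j=0}^{d-1}\mathbb F_{q^r}e_j$, and let $\varphi:D_P\to D_P$ be the $\sigma$-semilinear map with $\varphi(e_j)=e_{j+1}$ for $0\le j\le d-2$ and $\varphi(e_{d-1})=\sum_{j=0}^{d-1}a_je_j$. The map $\varphi^r$ is $\mathbb F_{q^r}$-linear, and its characteristic polynomial $\Psi(P)=\det(Y\,\mathrm{id}-\varphi^r)$ lies in $\mathbb F_q[Y]$. **Proposition.** Let $P\in\mathbb F_{q^r}[X,\sigma]$ be monic, and assume that $\Psi(P)=Q_1\cdots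 Q_s$ with pairwise distinct monic irreducible polynomials $Q_i\in\mathbb F_q[Y]$. Then for every $1\le i\le s$ there is a unique monic right-divisor $P_i$ of $P$ with $\Psi(P_i)=Q_i$. It is given by $P_i=\mathrm{rgcd}(P,Q_i(X^r))$. -/

import Mathlib

/-! ### Skew polynomial rings `K[X, σ]` -/

/-- The action of `ℕ` on `K` through the iterates of the ring endomorphism `σ`. -/
@[reducible] def iterateAction {K : Type*} [Field K] (σ : K →+* K) :
    MulSemiringAction (Multiplicative ℕ) K :=
  MulSemiringAction.compHom K (powersHom (K →+* K) σ)

/-- The skew polynomial ring `K[X, σ]`, in which `X * a = σ a * X`. It is Mathlib's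
`SkewPolynomial K`, with the multiplication that is determined by `σ`. -/
def SkewPoly {K : Type*} [Field K] (_σ : K →+* K) : Type _ := SkewPolynomial K

namespace SkewPoly

noncomputable instance {K : Type*} [Field K] (σ : K →+* K) : Ring (SkewPoly σ) :=
  letI := iterateAction σ
  inferInstanceAs (Ring (SkewPolynomial K))

/-- The constant skew polynomials. -/
noncomputable def C {K : Type*} [Field K] (σ : K →+* K) : K →+* SkewPoly σ :=
  letI := iterateAction σ
  (SkewPolynomial.CRingHom : K →+* SkewPolynomial K)

/-- The variable `X` of `K[X, σ]`. -/
noncomputable def X {K : Type*} [Field K] (σ : K →+* K) : SkewPoly σ :=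
  (SkewPolynomial.X : SkewPolynomial K)

/-- The defining commutation rule `X * a = σ a * X`. -/
theorem X_mul_C {K : Type*} [Field K] (σ : K →+* K) (a : K) :
    X σ * C σ a = C σ (σ a) * X σ := by
  let _ := iterateAction σ
  have h1 : (SkewPolynomial.X : SkewPolynomial K) * SkewPolynomial.C a =
      SkewPolynomial.C (SkewPolynomial.φ a) * SkewPolynomial.X := by
    rw [← SkewPolynomial.monomial_zero_left, SkewPolynomial.X_mul_monomial,
      SkewPolynomial.C_mul_X_eq_monomial]
  have h2 : SkewPolynomial.φ a = σ a := by
    change (powersHom (K →+* K) σ (Multiplicative.ofAdd 1)) a = σ a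
    simp
  rw [h2] at h1
  exact h1

/-- `P.coeff n` is the coefficient `a` of the term `a * X ^ n` of `P`. -/
def coeff {K : Type*} [Field K] {σ : K →+* K} (P : SkewPoly σ) (n : ℕ) : K :=
  SkewPolynomial.coeff (R := K) P n

/-- The degree of a skew polynomial (`0` for the zero polynomial). -/
def natDegree {K : Type*} [Field K] {σ : K →+* K} (P : SkewPoly σ) : ℕ :=
  (SkewPolynomial.support (R := K) P).sup id

/-- A skew polynomial is monic if its leading coefficient is `1`. -/
def Monic {K : Type*} [Field K] {σ : K →+* K} (P : SkewPoly σ) : Prop :=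
  P.coeff P.natDegree = 1

/-- `P` is a right-divisor of `Q`: `Q = U * P` for some `U`. -/
def RightDvd {K : Type*} [Field K] {σ : K →+* K} (P Q : SkewPoly σ) : Prop :=
  ∃ U : SkewPoly σ, Q = U * P

/-- `D` is a right greatest common divisor of `P` and `Q`. It is unique up to multiplication on
the left by a nonzero constant. -/
def IsRgcd {K : Type*} [Field K] {σ : K →+* K} (D P Q : SkewPoly σ) : Prop :=
  D.RightDvd P ∧ D.RightDvd Q ∧ ∀ E : SkewPoly σ, E.RightDvd P → E.RightDvd Q → E.RightDvd D

/-! ### The `φ`-module of a skew polynomial -/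

/-- For `P = X ^ d - ∑ aᵢ X ^ i` monic of degree `d`, the image under `φ` of the basis vector `eᵢ`
of `D_P = K ^ d`: it is `eᵢ₊₁` if `i + 1 < d`, and `∑ aⱼ eⱼ` if `i = d - 1`. -/
def phiBasis {K : Type*} [Field K] {σ : K →+* K} (P : SkewPoly σ) (i : Fin P.natDegree) :
    Fin P.natDegree → K :=
  if h : i.val + 1 < P.natDegree then Pi.single ⟨i.val + 1, h⟩ 1 else fun j => -P.coeff j.val

/-- The `σ`-semilinear map `φ` of the `φ`-module `D_P`. -/
def phi {K : Type*} [Field K] {σ : K →+* K} (P : SkewPoly σ) :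
    (Fin P.natDegree → K) →ₛₗ[σ] (Fin P.natDegree → K) where
  toFun v := ∑ i, σ (v i) • P.phiBasis i
  map_add' v w := by simp [add_smul, Finset.sum_add_distrib]
  map_smul' c v := by simp [Finset.smul_sum, mul_smul]

theorem phi_iterate_add {K : Type*} [Field K] {σ : K →+* K} (P : SkewPoly σ) (n : ℕ)
    (v w : Fin P.natDegree → K) : P.phi^[n] (v + w) = P.phi^[n] v + P.phi^[n] w := by
  induction n generalizing v w with
  | zero => rfl
  | succ n ih => simp only [Function.iterate_succ_apply, map_add, ih]

theorem phi_iterate_smul {K : Type*} [Field K] {σ : K →+* K} (P : SkewPoly σ) (n : ℕ)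
    (c : K) (v : Fin P.natDegree → K) : P.phi^[n] (c • v) = σ^[n] c • P.phi^[n] v := by
  induction n generalizing c v with
  | zero => rfl
  | succ n ih => simp only [Function.iterate_succ_apply, LinearMap.map_smulₛₗ, ih]

end SkewPoly

/-! ### Finite fields: `F = 𝔽_q`, `K = 𝔽_{q ^ r}` with `r = [K : F]` -/

/-- The Frobenius `σ : x ↦ x ^ q` of `K`, where `q` is the number of elements of `F`. -/
def frobHom (F K : Type*) [Field F] [Fintype F] [Field K] [Algebra F K] : K →+* K :=
  (FiniteField.frobeniusAlgHom F K : K →ₐ[F] K)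

theorem frobHom_apply (F K : Type*) [Field F] [Fintype F] [Field K] [Algebra F K] (x : K) :
    frobHom F K x = x ^ Fintype.card F := rfl

theorem frobHom_iterate_finrank (F K : Type*) [Field F] [Fintype F] [Field K] [Finite K]
    [Algebra F K] (x : K) : (frobHom F K)^[Module.finrank F K] x = x := by
  have h := pow_orderOf_eq_one (FiniteField.frobeniusAlgHom F K)
  rw [FiniteField.orderOf_frobeniusAlgHom] at h
  have h2 := DFunLike.congr_fun h x
  rw [AlgHom.coe_pow] at h2
  exact h2

/-- The elements of `K` that `σ` fixes are those of `F`. -/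
theorem mem_range_of_frobHom_eq (F K : Type*) [Field F] [Fintype F] [Field K] [Finite K]
    [Algebra F K] (x : K) (hx : frobHom F K x = x) : x ∈ (algebraMap F K).range := by
  have hfix : ∀ g : Gal(K/F), g x = x := by
    intro g
    obtain ⟨n, hn⟩ := (FiniteField.bijective_frobeniusAlgEquivOfAlgebraic_pow F K).2 g
    have hn' : FiniteField.frobeniusAlgEquivOfAlgebraic F K ^ n.1 = g := hn
    rw [← hn', AlgEquiv.coe_pow]
    exact Function.iterate_fixed hx n.1
  exact (IsGalois.mem_range_algebraMap_iff_fixed x).2 hfix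

namespace SkewPoly

/-- The `K`-linear map `φ ^ r` of `D_P`, where `r = [K : F]`. -/
noncomputable def phiPow {F K : Type*} [Field F] [Fintype F] [Field K] [Finite K] [Algebra F K]
    (P : SkewPoly (frobHom F K)) : (Fin P.natDegree → K) →ₗ[K] (Fin P.natDegree → K) where
  toFun := P.phi^[Module.finrank F K]
  map_add' := P.phi_iterate_add _
  map_smul' c v := by
    rw [phi_iterate_smul, frobHom_iterate_finrank, RingHom.id_apply]

/-- The matrix of `φ`. -/
def companion {K : Type*} [Field K] {σ : K →+* K} (P : SkewPoly σ) :
    Matrix (Fin P.natDegree) (Fin P.natDegree) K :=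
  Matrix.of fun i j => P.phiBasis j i

/-- The matrix `Γ * σ(Γ) * ⋯ * σ ^ (n - 1) (Γ)` of `φ ^ n`, where `Γ` is the matrix of `φ`. -/
def companionPow {K : Type*} [Field K] {σ : K →+* K} (P : SkewPoly σ) :
    ℕ → Matrix (Fin P.natDegree) (Fin P.natDegree) K
  | 0 => 1
  | n + 1 => P.companion * (P.companionPow n).map σ

theorem phi_eq_mulVec {K : Type*} [Field K] {σ : K →+* K} (P : SkewPoly σ)
    (v : Fin P.natDegree → K) : P.phi v = P.companion.mulVec (σ ∘ v) := by
  ext i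
  simp [phi, companion, Matrix.mulVec, dotProduct, Finset.sum_apply, mul_comm]

theorem phi_iterate_eq_mulVec {K : Type*} [Field K] {σ : K →+* K} (P : SkewPoly σ) (n : ℕ)
    (v : Fin P.natDegree → K) :
    P.phi^[n] v = (P.companionPow n).mulVec (σ^[n] ∘ v) := by
  induction n with
  | zero => simp [companionPow]
  | succ n ih =>
    rw [Function.iterate_succ_apply', ih, phi_eq_mulVec, companionPow, ← Matrix.mulVec_mulVec]
    congr 1
    ext i
    simp [Matrix.mulVec, dotProduct, -Function.iterate_succ, Function.iterate_succ_apply']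

theorem companionPow_succ' {K : Type*} [Field K] {σ : K →+* K} (P : SkewPoly σ) (n : ℕ) :
    P.companionPow (n + 1) = P.companionPow n * P.companion.map σ^[n] := by
  induction n with
  | zero =>
    have h : P.companion.map (id : K → K) = P.companion := Matrix.map_id _
    simp [companionPow, h]
  | succ n ih =>
    conv_lhs => rw [companionPow, ih]
    rw [Matrix.map_mul, ← mul_assoc, Matrix.map_map, ← Function.iterate_succ']
    rfl

/-- The characteristic polynomial of `φ ^ r` has coefficients in `F`. -/
theorem exists_map_eq_charpoly_phiPow {F K : Type*} [Field F] [Fintype F] [Field K] [Finite K]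
    [Algebra F K] (P : SkewPoly (frobHom F K)) :
    ∃ Q : Polynomial F, Q.map (algebraMap F K) = P.phiPow.charpoly := by
  obtain ⟨m, hm⟩ : ∃ m, Module.finrank F K = m + 1 :=
    Nat.exists_eq_succ_of_ne_zero Module.finrank_pos.ne'
  have hid : ((frobHom F K)^[m + 1] : K → K) = id := by
    funext x
    rw [← hm]
    exact frobHom_iterate_finrank F K x
  have h1 : P.phiPow.charpoly = (P.companionPow (m + 1)).charpoly := by
    have : P.phiPow = Matrix.toLin' (P.companionPow (m + 1)) := by
      ext1 i
      ext1
      simp only [LinearMap.comp_apply, Matrix.toLin'_apply]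
      change P.phi^[Module.finrank F K] _ = _
      rw [hm, phi_iterate_eq_mulVec, hid]
      rfl
    rw [this, Matrix.charpoly_toLin']
  have h2 : (P.companionPow (m + 1)).charpoly.map (frobHom F K) = (P.companionPow (m + 1)).charpoly := by
    rw [← Matrix.charpoly_map]
    conv_lhs => rw [companionPow_succ']
    rw [Matrix.map_mul, Matrix.map_map, ← Function.iterate_succ', hid,
      Matrix.map_id, Matrix.charpoly_mul_comm, companionPow]
  have h3 : P.phiPow.charpoly ∈ Polynomial.lifts (algebraMap F K) := by
    rw [Polynomial.lifts_iff_coeff_lifts]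
    intro n
    refine mem_range_of_frobHom_eq F K _ ?_
    rw [h1]
    conv_rhs => rw [← h2, Polynomial.coeff_map]
  exact (Polynomial.mem_lifts _).1 h3

/-- `Ψ(P) ∈ F[Y]`: the characteristic polynomial of `φ ^ r` on `D_P`, as a polynomial over `F`. -/
noncomputable def Psi {F K : Type*} [Field F] [Fintype F] [Field K] [Finite K] [Algebra F K]
    (P : SkewPoly (frobHom F K)) : Polynomial F :=
  P.exists_map_eq_charpoly_phiPow.choose

theorem map_Psi {F K : Type*} [Field F] [Fintype F] [Field K] [Finite K] [Algebra F K]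
    (P : SkewPoly (frobHom F K)) : P.Psi.map (algebraMap F K) = P.phiPow.charpoly :=
  P.exists_map_eq_charpoly_phiPow.choose_spec

/-- `Q(X ^ r) ∈ K[X, σ]` for `Q ∈ F[Y]`, where `r = [K : F]`. -/
noncomputable def evalXPow {F : Type*} (K : Type*) [Field F] [Fintype F] [Field K] [Algebra F K]
    (Q : Polynomial F) : SkewPoly (frobHom F K) :=
  Q.eval₂ ((C (frobHom F K)).comp (algebraMap F K)) (X (frobHom F K) ^ Module.finrank F K)

end SkewPoly

/-! Write `R = K[X, σ]`. The φ-module `D_P` is the left module `R / R P`, with `X` acting as `φ` and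
the class of `T` being `T • e₀` (`toD`, whose kernel is found in `toD_eq_zero_iff`). As `σ ^ r = id`
and `σ` fixes `F`, each `Q(X ^ r)` with `Q ∈ F[Y]` is central and acts on `D_P` as `Q(φ ^ r)`. Hence
`P` right-divides `Q(X ^ r)` exactly when `Q(φ ^ r) = 0`, and Cayley–Hamilton makes `P` right-divide
`Ψ(P)(X ^ r)`.

Let `G` be the monic rgcd of `P` and `Q i (X ^ r)`. The surjection `D_P → D_G` gives `Ψ(G) ∣ Ψ(P)`.
Since `Q i` kills `D_G`, `Ψ(G)` is coprime to the other `Q j`, so it is `1` or `Q i`. If it were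
`1`, then `G = 1`, and Bézout would make `Q i (φ ^ r)` invertible on `D_P`; then `Q i` would be
coprime to its multiple `Ψ(P)`.

For uniqueness, a monic right-divisor `S` of `P` with `Ψ(S) = Q i` right-divides `Q i (X ^ r)`,
hence `G`. Both have degree `deg (Q i)`, so they agree. -/

/-- If `p(f)` is invertible, then `p` is coprime to the characteristic polynomial of `f`. -/
theorem isCoprime_charpoly_of_isUnit_aeval {K V : Type*} [Field K] [AddCommGroup V] [Module K V]
    [Module.Finite K V] (f : Module.End K V) (p : Polynomial K)
    (h : IsUnit (Polynomial.aeval f p)) : IsCoprime p f.charpoly := by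
  let b := Module.Free.chooseBasis K V
  let M := LinearMap.toMatrix b b f
  have hM : IsUnit (Polynomial.aeval M p) := by
    have := h.map (LinearMap.toMatrixAlgEquiv b)
    rwa [← Polynomial.aeval_algHom_apply] at this
  rw [← LinearMap.charpoly_toMatrix f b,
    Polynomial.isCoprime_iff_aeval_ne_zero_of_isAlgClosed K (AlgebraicClosure K)]
  -- A common root `a` is an eigenvalue of `M` over the algebraic closure, so `p(a) = 0` is in the
  -- spectrum of the invertible matrix `p(M)`.
  by_contra! hcon
  obtain ⟨a, ha, ha'⟩ := hcon
  let g := (Algebra.ofId K (AlgebraicClosure K)).mapMatrix (m := Module.Free.ChooseBasisIndex K V)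
  have hg : IsUnit (Polynomial.aeval (g M) p) := by
    rw [Polynomial.aeval_algHom_apply]
    exact hM.map g
  have hroot : (g M).charpoly.IsRoot a := by
    change ((M.map (algebraMap K (AlgebraicClosure K))).charpoly).IsRoot a
    rw [Matrix.charpoly_map, Polynomial.IsRoot.def, Polynomial.eval_map_algebraMap]
    exact ha'
  have hs := Matrix.mem_spectrum_of_isRoot_charpoly hroot
  have h0 := spectrum.subset_polynomial_aeval (g M)
    (p.map (algebraMap K (AlgebraicClosure K))) ⟨a, hs, rfl⟩
  simp only [Polynomial.eval_map_algebraMap, ha, Polynomial.aeval_map_algebraMap] at h0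
  exact spectrum.zero_notMem _ hg h0

/-- The characteristic polynomial of the map induced on a quotient divides the characteristic
polynomial of the map. -/
theorem charpoly_dvd_of_surjective {K V W : Type*} [Field K] [AddCommGroup V] [Module K V]
    [Module.Finite K V] [AddCommGroup W] [Module K W] [Module.Finite K W]
    (e : Module.End K V) (g : Module.End K W) (f : V →ₗ[K] W) (hf : Function.Surjective f)
    (h : ∀ v, f (e v) = g (f v)) : g.charpoly ∣ e.charpoly := by
  let bk := Module.Free.chooseBasis K f.ker
  let bW := Module.Free.chooseBasis K W
  let q := f.quotKerEquivOfSurjective hf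
  -- In a basis adapted to `ker f`, the matrix of `e` is block triangular, and its lower right block
  -- is the matrix of `g`.
  let b := Module.Basis.sumQuot bk (bW.map q.symm)
  let A := (LinearMap.toMatrix b b e).toBlocks₁₁
  let B := (LinearMap.toMatrix b b e).toBlocks₁₂
  have hrepr : ∀ v j, b.repr v (Sum.inr j) = bW.repr (f v) j := by
    intro v j
    rw [Module.Basis.sumQuot_repr_inr]
    simp [q]
  have hM : LinearMap.toMatrix b b e =
      Matrix.fromBlocks A B 0 (LinearMap.toMatrix bW bW g) := by
    ext u v
    rcases u with i | j
    · rcases v with k | l <;> rfl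
    · rcases v with k | l
      · simp only [LinearMap.toMatrix_apply, hrepr, h, Matrix.fromBlocks_apply₂₁]
        have : f (b (Sum.inl k)) = 0 := by
          simp only [b, Module.Basis.sumQuot_inl]
          exact (bk k).2
        simp [this]
      · simp only [LinearMap.toMatrix_apply, hrepr, h, Matrix.fromBlocks_apply₂₂]
        congr 3
        apply bW.repr.injective
        ext j
        rw [← hrepr]
        simp [Finsupp.single_apply]
  rw [← LinearMap.charpoly_toMatrix e b, ← LinearMap.charpoly_toMatrix g bW, hM,
    Matrix.charpoly_fromBlocks_zero₂₁]
  exact dvd_mul_left _ _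

/-- A monic non-constant divisor of a product of distinct monic irreducible polynomials that is
coprime to all of these but one is equal to that one. -/
theorem eq_of_dvd_prod_of_isCoprime {F ι : Type*} [Field F] [Fintype ι]
    (Q : ι → Polynomial F) (hQmonic : ∀ i, (Q i).Monic)
    (hQirr : ∀ i, Irreducible (Q i)) (i : ι) (A : Polynomial F) (hA : A.Monic) (hA1 : A ≠ 1)
    (hdvd : A ∣ ∏ j, Q j) (hcop : ∀ j, j ≠ i → IsCoprime (Q j) A) : A = Q i := by
  classical
  have hAi : A ∣ Q i := by
    rw [← Finset.mul_prod_erase _ _ (Finset.mem_univ i)] at hdvd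
    refine IsCoprime.dvd_of_dvd_mul_right (IsCoprime.prod_right fun j hj => ?_) hdvd
    exact (hcop j (Finset.ne_of_mem_erase hj)).symm
  rcases (hQirr i).dvd_iff.1 hAi with h | h
  · exact absurd (hA.eq_one_of_isUnit h) hA1
  · exact (Polynomial.eq_of_monic_of_associated (hQmonic i) hA h).symm

/-! ### Coefficients, right division and Bézout in `K[X, σ]` -/

namespace SkewPoly

section Basic

variable {K : Type*} [Field K] {σ : K →+* K}

@[ext]
theorem ext {P Q : SkewPoly σ} (h : ∀ n, P.coeff n = Q.coeff n) : P = Q :=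
  SkewPolynomial.ext h

theorem coeff_add (P Q : SkewPoly σ) (n : ℕ) : (P + Q).coeff n = P.coeff n + Q.coeff n :=
  SkewPolynomial.coeff_add P Q n

theorem coeff_sub (P Q : SkewPoly σ) (n : ℕ) : (P - Q).coeff n = P.coeff n - Q.coeff n :=
  SkewPolynomial.coeff_sub (R := K) P Q n

theorem coeff_zero (n : ℕ) : (0 : SkewPoly σ).coeff n = 0 := rfl

theorem coeff_one (n : ℕ) : (1 : SkewPoly σ).coeff n = if n = 0 then 1 else 0 := by
  let _ := iterateAction σ
  exact (SkewPolynomial.coeff_one n).trans (by simp [eq_comm])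

theorem coeff_C_mul (a : K) (P : SkewPoly σ) (n : ℕ) : (C σ a * P).coeff n = a * P.coeff n := by
  let _ := iterateAction σ
  refine (SkewMonoidAlgebra.coeff_single_mul_aux (G := Multiplicative ℕ) (k := K) P (r := a)
    (x := 1) (y := .ofAdd n) (z := .ofAdd n) (by simp)).trans ?_
  rw [one_smul]
  rfl

theorem coeff_X_mul_succ (P : SkewPoly σ) (n : ℕ) :
    (X σ * P).coeff (n + 1) = σ (P.coeff n) := by
  let _ := iterateAction σ
  refine (SkewMonoidAlgebra.coeff_single_mul_aux (G := Multiplicative ℕ) (k := K) P (r := 1)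
    (x := .ofAdd 1) (y := .ofAdd (n + 1)) (z := .ofAdd n) (fun a => ?_)).trans ?_
  · rw [add_comm, ofAdd_add, mul_right_inj]
  · rw [one_mul]
    change (powersHom (K →+* K) σ (Multiplicative.ofAdd 1)) _ = _
    simp only [powersHom_apply, toAdd_ofAdd, pow_one]
    rfl

theorem coeff_X_mul_zero (P : SkewPoly σ) : (X σ * P).coeff 0 = 0 := by
  let _ := iterateAction σ
  refine (SkewMonoidAlgebra.coeff_single_mul_of_not_exists_mul (G := Multiplicative ℕ) (k := K)
    (g := .ofAdd 1) (g' := .ofAdd 0) 1 P ?_)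
  rintro ⟨d, h⟩
  have := congrArg Multiplicative.toAdd h
  simp at this
  omega

theorem coeff_eq_zero_of_natDegree_lt {P : SkewPoly σ} {n : ℕ} (h : P.natDegree < n) :
    P.coeff n = 0 := by
  by_contra hn
  have : n ∈ SkewPolynomial.support (R := K) P := SkewPolynomial.mem_support_iff.2 hn
  exact absurd (Finset.le_sup (f := id) this) (not_le.2 h)

theorem le_natDegree {P : SkewPoly σ} {n : ℕ} (h : P.coeff n ≠ 0) : n ≤ P.natDegree := by
  by_contra! hn
  exact h (coeff_eq_zero_of_natDegree_lt hn)

theorem coeff_natDegree_ne_zero {P : SkewPoly σ} (h : P ≠ 0) : P.coeff P.natDegree ≠ 0 := by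
  have hne : (SkewPolynomial.support (R := K) P).Nonempty := by
    refine Finset.nonempty_iff_ne_empty.2 fun h0 => h ?_
    exact (SkewPolynomial.support_eq_empty (R := K)).1 h0
  obtain ⟨n, hn, hn'⟩ := Finset.exists_mem_eq_sup _ hne id
  have : P.natDegree = n := hn'
  rw [this]
  exact SkewPolynomial.mem_support_iff.1 hn

theorem natDegree_lt_of_coeff {P : SkewPoly σ} {d : ℕ} (h : ∀ n, d ≤ n → P.coeff n = 0)
    (hP : P ≠ 0) : P.natDegree < d := by
  by_contra! hd
  exact coeff_natDegree_ne_zero hP (h _ hd)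

theorem natDegree_eq {P : SkewPoly σ} {d : ℕ} (h : ∀ n, d < n → P.coeff n = 0)
    (hd : P.coeff d ≠ 0) : P.natDegree = d := by
  refine le_antisymm ?_ (le_natDegree hd)
  by_contra! hlt
  exact coeff_natDegree_ne_zero (fun h0 => hd (by rw [h0, coeff_zero])) (h _ hlt)

theorem coeff_X_pow_mul_add (P : SkewPoly σ) (k n : ℕ) :
    (X σ ^ k * P).coeff (n + k) = σ^[k] (P.coeff n) := by
  induction k with
  | zero => simp
  | succ k ih =>
    rw [pow_succ', mul_assoc, ← add_assoc, coeff_X_mul_succ, ih, Function.iterate_succ_apply']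

theorem coeff_X_pow_mul_of_lt (P : SkewPoly σ) {k n : ℕ} (h : n < k) :
    (X σ ^ k * P).coeff n = 0 := by
  induction k generalizing n with
  | zero => omega
  | succ k ih =>
    rw [pow_succ', mul_assoc]
    rcases n with _ | n
    · exact coeff_X_mul_zero _
    · rw [coeff_X_mul_succ, ih (by omega), map_zero]

theorem coeff_X_pow (k n : ℕ) : (X σ ^ k).coeff n = if n = k then 1 else 0 := by
  rw [← mul_one (X σ ^ k)]
  by_cases h : n < k
  · rw [coeff_X_pow_mul_of_lt _ h, if_neg h.ne]
  · obtain ⟨m, rfl⟩ := Nat.exists_eq_add_of_le' (not_lt.1 h)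
    rw [coeff_X_pow_mul_add, coeff_one]
    split_ifs <;> simp_all

theorem coeff_sum {ι : Type*} (s : Finset ι) (f : ι → SkewPoly σ) (n : ℕ) :
    (∑ i ∈ s, f i).coeff n = ∑ i ∈ s, (f i).coeff n := by
  classical
  induction s using Finset.induction_on with
  | empty => simp [coeff_zero]
  | insert i s hi ih => rw [Finset.sum_insert hi, Finset.sum_insert hi, coeff_add, ih]

theorem eq_sum_of_coeff_eq_zero {P : SkewPoly σ} {d : ℕ} (h : ∀ n, d ≤ n → P.coeff n = 0) :
    P = ∑ n ∈ Finset.range d, C σ (P.coeff n) * X σ ^ n := by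
  ext m
  simp only [coeff_sum, coeff_C_mul, coeff_X_pow, mul_ite, mul_one, mul_zero, Finset.sum_ite_eq,
    Finset.mem_range]
  split_ifs with hm
  · rfl
  · exact h _ (not_lt.1 hm)

/-- Left multiplication is determined by constants and `X`. -/
theorem mul_induction {p : SkewPoly σ → Prop} (T : SkewPoly σ) (zero : p 0)
    (add : ∀ A B, p A → p B → p (A + B)) (C_mul : ∀ a A, p A → p (C σ a * A))
    (X_mul : ∀ A, p A → p (X σ * A)) (hT : p T) (U : SkewPoly σ) : p (U * T) := by
  have hX : ∀ n, p (X σ ^ n * T) := by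
    intro n
    induction n with
    | zero => simpa using hT
    | succ n ih =>
      rw [pow_succ', mul_assoc]
      exact X_mul _ ih
  rw [eq_sum_of_coeff_eq_zero (P := U) (d := U.natDegree + 1)
    (fun n hn => coeff_eq_zero_of_natDegree_lt hn), Finset.sum_mul]
  refine Finset.sum_induction _ p add zero fun n _ => ?_
  rw [mul_assoc]
  exact C_mul _ _ (hX n)

/-- Right division with remainder by a monic skew polynomial. -/
theorem exists_eq_mul_add {P : SkewPoly σ} (hP : P.Monic) (T : SkewPoly σ) :
    ∃ U V : SkewPoly σ, T = U * P + V ∧ ∀ n, P.natDegree ≤ n → V.coeff n = 0 := by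
  suffices h : ∀ m, ∀ T : SkewPoly σ, (∀ n, m ≤ n → T.coeff n = 0) →
      ∃ U V : SkewPoly σ, T = U * P + V ∧ ∀ n, P.natDegree ≤ n → V.coeff n = 0 from
    h (T.natDegree + 1) T fun n hn => coeff_eq_zero_of_natDegree_lt hn
  intro m
  induction m with
  | zero => exact fun T hT => ⟨0, T, by simp, fun n _ => hT n n.zero_le⟩
  | succ m ih =>
    intro T hT
    by_cases hm : P.natDegree ≤ m
    · obtain ⟨k, rfl⟩ := Nat.exists_eq_add_of_le hm
      -- `X ^ k * P` is again monic because `σ ^ k` fixes `1`, so the top coefficient of `T`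
      -- cancels.
      obtain ⟨U, V, hUV, hV⟩ := ih (T - C σ (T.coeff (P.natDegree + k)) * (X σ ^ k * P)) (by
        intro n hn
        obtain ⟨l, rfl⟩ := Nat.exists_eq_add_of_le' (m := k) (n := n) (by omega)
        rw [coeff_sub, coeff_C_mul, coeff_X_pow_mul_add]
        rcases (show P.natDegree ≤ l by omega).eq_or_lt with h | h
        · rw [← h, show P.coeff P.natDegree = 1 from hP, iterate_map_one]
          simp
        · rw [coeff_eq_zero_of_natDegree_lt h, hT _ (by omega), iterate_map_zero]
          simp)
      refine ⟨U + C σ (T.coeff (P.natDegree + k)) * X σ ^ k, V, ?_, hV⟩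
      rw [add_mul, add_right_comm, ← hUV, mul_assoc]
      abel
    · exact ⟨0, T, by simp, fun n hn => hT n (by omega)⟩

/-- Bézout: two skew polynomials, the first monic, have a monic right greatest common divisor,
and it lies in the left ideal that they generate. -/
theorem exists_monic_isRgcd {P : SkewPoly σ} (hP : P.Monic) (T : SkewPoly σ) :
    ∃ D : SkewPoly σ, D.Monic ∧ D.IsRgcd P T ∧ ∃ A B : SkewPoly σ, D = A * P + B * T := by
  classical
  -- The gcd is a monic element of least degree in the left ideal generated by `P` and `T`.
  let p : ℕ → Prop := fun d => ∃ D : SkewPoly σ, D.Monic ∧ D.natDegree = d ∧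
    ∃ A B : SkewPoly σ, D = A * P + B * T
  have hp : ∃ d, p d := ⟨_, P, hP, rfl, 1, 0, by simp⟩
  obtain ⟨D, hD, hd, A, B, hAB⟩ := Nat.find_spec hp
  have hmin : ∀ U W : SkewPoly σ, D.RightDvd (U * P + W * T) := by
    intro U W
    obtain ⟨Q, V, hQV, hV⟩ := exists_eq_mul_add hD (U * P + W * T)
    refine ⟨Q, ?_⟩
    suffices hV0 : V = 0 by rw [hQV, hV0, add_zero]
    by_contra hV0
    have hlt := natDegree_lt_of_coeff hV hV0
    have hc := coeff_natDegree_ne_zero hV0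
    have hdeg : (C σ (V.coeff V.natDegree)⁻¹ * V).natDegree = V.natDegree := by
      refine natDegree_eq (fun n hn => ?_) ?_
      · rw [coeff_C_mul, coeff_eq_zero_of_natDegree_lt hn, mul_zero]
      · rw [coeff_C_mul, inv_mul_cancel₀ hc]
        exact one_ne_zero
    -- A nonzero remainder, scaled to be monic, would be an element of the ideal of smaller degree.
    refine Nat.find_min hp (hd ▸ hlt) ⟨C σ (V.coeff V.natDegree)⁻¹ * V, ?_, hdeg,
      C σ (V.coeff V.natDegree)⁻¹ * (U - Q * A), C σ (V.coeff V.natDegree)⁻¹ * (W - Q * B), ?_⟩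
    · rw [Monic, hdeg, coeff_C_mul, inv_mul_cancel₀ hc]
    · rw [mul_assoc, mul_assoc, ← mul_add]
      congr 1
      rw [← add_sub_cancel_left (Q * D) V, ← hQV, hAB]
      noncomm_ring
  refine ⟨D, hD, ⟨by simpa using hmin 1 0, by simpa using hmin 0 1, ?_⟩, A, B, hAB⟩
  rintro E ⟨U, hU⟩ ⟨W, hW⟩
  refine ⟨A * U + B * W, ?_⟩
  rw [hAB, add_mul, mul_assoc, mul_assoc, ← hU, ← hW]

end Basic

end SkewPoly

/-! ### `D_P` as the cyclic module `K[X, σ] / K[X, σ] P` -/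

namespace SkewPoly

section Module

variable {K : Type*} [Field K] {σ : K →+* K}

/-- The vector `e₀` of `D_P` (`0` if `P` has degree `0`). -/
def e0 (P : SkewPoly σ) : Fin P.natDegree → K := fun j => if j.val = 0 then 1 else 0

/-- The vector `T • e₀` of `D_P`, where `X` acts as `φ`. -/
noncomputable def toD (P T : SkewPoly σ) : Fin P.natDegree → K :=
  ∑ n ∈ Finset.range (T.natDegree + 1), T.coeff n • P.phi^[n] P.e0

theorem toD_eq_sum (P : SkewPoly σ) {T : SkewPoly σ} {m : ℕ} (h : ∀ n, m ≤ n → T.coeff n = 0) :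
    P.toD T = ∑ n ∈ Finset.range m, T.coeff n • P.phi^[n] P.e0 := by
  have key : ∀ a b, a ≤ b → (∀ n, a ≤ n → T.coeff n = 0) →
      ∑ n ∈ Finset.range a, T.coeff n • P.phi^[n] P.e0 =
        ∑ n ∈ Finset.range b, T.coeff n • P.phi^[n] P.e0 := fun a b hab ha =>
    Finset.sum_subset (Finset.range_mono hab) fun n _ hn => by
      rw [ha n (by simpa using hn), zero_smul]
  have hT : ∀ n, T.natDegree + 1 ≤ n → T.coeff n = 0 := fun n hn =>
    coeff_eq_zero_of_natDegree_lt hn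
  rw [toD, key _ _ (le_max_left _ m) hT, key _ _ (le_max_right (T.natDegree + 1) m) h]

theorem toD_add (P A B : SkewPoly σ) : P.toD (A + B) = P.toD A + P.toD B := by
  let m := max (A.natDegree + 1) (B.natDegree + 1)
  have hA : ∀ n, m ≤ n → A.coeff n = 0 := fun n hn =>
    coeff_eq_zero_of_natDegree_lt ((le_max_left _ _).trans hn)
  have hB : ∀ n, m ≤ n → B.coeff n = 0 := fun n hn =>
    coeff_eq_zero_of_natDegree_lt ((le_max_right _ _).trans hn)
  rw [toD_eq_sum P hA, toD_eq_sum P hB, toD_eq_sum P (T := A + B) (m := m) fun n hn => by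
    rw [coeff_add, hA n hn, hB n hn, add_zero]]
  simp only [coeff_add, add_smul, Finset.sum_add_distrib]

theorem toD_zero (P : SkewPoly σ) : P.toD 0 = 0 := by
  simpa using P.toD_add 0 0

theorem toD_C_mul (P : SkewPoly σ) (a : K) (A : SkewPoly σ) :
    P.toD (C σ a * A) = a • P.toD A := by
  have hA : ∀ n, A.natDegree + 1 ≤ n → A.coeff n = 0 := fun n hn =>
    coeff_eq_zero_of_natDegree_lt hn
  rw [toD_eq_sum P hA, toD_eq_sum P (T := C σ a * A) (m := A.natDegree + 1) fun n hn => by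
    rw [coeff_C_mul, hA n hn, mul_zero]]
  simp only [coeff_C_mul, Finset.smul_sum, mul_smul]

/-- The semilinearity of `φ` matches the rule `X a = σ(a) X`; together with additivity and
`toD_C_mul`, this makes `toD` a map of left modules. -/
theorem toD_X_mul (P A : SkewPoly σ) : P.toD (X σ * A) = P.phi (P.toD A) := by
  have hA : ∀ n, A.natDegree + 1 ≤ n → A.coeff n = 0 := fun n hn =>
    coeff_eq_zero_of_natDegree_lt hn
  rw [toD_eq_sum P hA, toD_eq_sum P (T := X σ * A) (m := A.natDegree + 1 + 1) fun n hn => by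
    obtain ⟨n, rfl⟩ := Nat.exists_eq_add_of_le' (show 1 ≤ n by omega)
    rw [coeff_X_mul_succ, hA n (by omega), map_zero]]
  rw [Finset.sum_range_succ', coeff_X_mul_zero, zero_smul, add_zero, map_sum]
  simp only [coeff_X_mul_succ, LinearMap.map_smulₛₗ, Function.iterate_succ_apply']

theorem toD_X_pow_mul (P : SkewPoly σ) (n : ℕ) (A : SkewPoly σ) :
    P.toD (X σ ^ n * A) = P.phi^[n] (P.toD A) := by
  induction n with
  | zero => simp
  | succ n ih => rw [pow_succ', mul_assoc, toD_X_mul, ih, Function.iterate_succ_apply']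

theorem toD_mul_eq_zero {P T : SkewPoly σ} (hT : P.toD T = 0) (U : SkewPoly σ) :
    P.toD (U * T) = 0 := by
  refine mul_induction (p := fun A => P.toD A = 0) T P.toD_zero ?_ ?_ ?_ hT U
  · intro A B hA hB
    rw [toD_add, hA, hB, add_zero]
  · intro a A hA
    rw [toD_C_mul, hA, smul_zero]
  · intro A hA
    rw [toD_X_mul, hA, map_zero]

theorem phi_single (P : SkewPoly σ) (i : Fin P.natDegree) :
    P.phi (Pi.single i 1) = P.phiBasis i := by
  change ∑ j, σ ((Pi.single i 1 : Fin P.natDegree → K) j) • P.phiBasis j = _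
  rw [Finset.sum_eq_single i]
  · simp
  · intro j _ hj
    simp [hj]
  · simp

theorem phi_iterate_e0 (P : SkewPoly σ) {n : ℕ} (h : n < P.natDegree) :
    P.phi^[n] P.e0 = Pi.single ⟨n, h⟩ 1 := by
  induction n with
  | zero =>
    ext j
    simp [e0, Pi.single_apply, Fin.ext_iff]
  | succ n ih =>
    rw [Function.iterate_succ_apply', ih (by omega), phi_single, phiBasis, dif_pos h]

theorem toD_apply_of_coeff_eq_zero (P : SkewPoly σ) {T : SkewPoly σ}
    (h : ∀ n, P.natDegree ≤ n → T.coeff n = 0) (j : Fin P.natDegree) :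
    P.toD T j = T.coeff j := by
  rw [toD_eq_sum P h, Finset.sum_range, Finset.sum_apply, Finset.sum_eq_single j]
  · rw [phi_iterate_e0 P j.2]
    simp
  · intro i _ hi
    rw [phi_iterate_e0 P i.2]
    simp [hi.symm]
  · simp

/-- With `d = deg P`, the vector `φ ^ d (e₀) = φ (e_{d-1})` is by definition the negative of the
lower coefficients of `P`. -/
theorem toD_self {P : SkewPoly σ} (hP : P.Monic) : P.toD P = 0 := by
  ext j
  obtain ⟨m, hm⟩ : ∃ m, P.natDegree = m + 1 := Nat.exists_eq_succ_of_ne_zero (by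
    have := j.2
    omega)
  have h1 : P.phi^[P.natDegree] P.e0 = fun j => -P.coeff j.val := by
    have : P.phi^[P.natDegree] P.e0 = P.phi^[m + 1] P.e0 :=
      congrArg (fun k => P.phi^[k] P.e0) hm
    rw [this, Function.iterate_succ_apply', phi_iterate_e0 P (by omega : m < P.natDegree),
      phi_single, phiBasis, dif_neg (by simp [hm])]
  rw [toD, Finset.sum_range_succ, h1, show P.coeff P.natDegree = 1 from hP, one_smul,
    Finset.sum_range, Pi.add_apply, Finset.sum_apply, Finset.sum_eq_single j]
  · rw [phi_iterate_e0 P j.2]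
    simp
  · intro i _ hi
    rw [phi_iterate_e0 P i.2]
    simp [hi.symm]
  · simp

/-- Modulo `P`, `T` may be replaced by its remainder, whose coefficients are the coordinates of its
image in `D_P`. -/
theorem toD_eq_zero_iff {P : SkewPoly σ} (hP : P.Monic) (T : SkewPoly σ) :
    P.toD T = 0 ↔ P.RightDvd T := by
  constructor
  · intro h
    obtain ⟨U, V, rfl, hV⟩ := exists_eq_mul_add hP T
    rw [toD_add, toD_mul_eq_zero (toD_self hP), zero_add] at h
    refine ⟨U, ?_⟩
    suffices hV0 : V = 0 by rw [hV0, add_zero]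
    ext n
    rcases le_or_gt P.natDegree n with hn | hn
    · exact hV n hn
    · rw [← toD_apply_of_coeff_eq_zero P hV ⟨n, hn⟩, h]
      rfl
  · rintro ⟨U, rfl⟩
    exact toD_mul_eq_zero (toD_self hP) U

/-- The skew polynomial of degree less than `d` with given coefficients. -/
noncomputable def ofVec (σ : K →+* K) {d : ℕ} (v : Fin d → K) : SkewPoly σ :=
  ∑ j, C σ (v j) * X σ ^ j.val

theorem toD_ofVec (P : SkewPoly σ) {d : ℕ} (v : Fin d → K) :
    P.toD (ofVec σ v) = ∑ j, v j • P.phi^[j.val] P.e0 := by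
  have hsum : ∀ s : Finset (Fin d), P.toD (∑ j ∈ s, C σ (v j) * X σ ^ j.val) =
      ∑ j ∈ s, P.toD (C σ (v j) * X σ ^ j.val) := by
    intro s
    classical
    induction s using Finset.induction_on with
    | empty => simp [toD_zero]
    | insert i s hi ih => rw [Finset.sum_insert hi, Finset.sum_insert hi, toD_add, ih]
  have h1 : P.toD 1 = P.e0 := by
    rw [toD_eq_sum P (m := 1) (fun n hn => by rw [coeff_one, if_neg (by omega)])]
    simp [coeff_one]
  rw [ofVec, hsum]
  refine Finset.sum_congr rfl fun j _ => ?_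
  rw [toD_C_mul, ← mul_one (X σ ^ j.val), toD_X_pow_mul, h1]

theorem toD_ofVec_self (P : SkewPoly σ) (v : Fin P.natDegree → K) : P.toD (ofVec σ v) = v := by
  rw [toD_ofVec]
  ext j
  rw [Finset.sum_apply, Finset.sum_eq_single j]
  · rw [phi_iterate_e0 P j.2]
    simp
  · intro i _ hi
    rw [phi_iterate_e0 P i.2]
    simp [hi.symm]
  · simp

/-- The `K`-linear map `D_P → D_G`, `e_j ↦ φ ^ j (e₀)`. -/
noncomputable def quotientMap (P G : SkewPoly σ) :
    (Fin P.natDegree → K) →ₗ[K] (Fin G.natDegree → K) where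
  toFun v := G.toD (ofVec σ v)
  map_add' v w := by simp [toD_ofVec, add_smul, Finset.sum_add_distrib]
  map_smul' c v := by simp [toD_ofVec, Finset.smul_sum, mul_smul]

theorem toD_congr {P T T' : SkewPoly σ} (hP : P.Monic) (h : P.RightDvd (T' - T)) :
    P.toD T' = P.toD T := by
  rw [← sub_add_cancel T' T, toD_add, (toD_eq_zero_iff hP _).2 h, zero_add]

theorem toD_sub (P A B : SkewPoly σ) : P.toD (A - B) = P.toD A - P.toD B := by
  rw [eq_sub_iff_add_eq, ← toD_add, sub_add_cancel]

theorem RightDvd.trans {A B D : SkewPoly σ} (h : A.RightDvd B) (h' : B.RightDvd D) :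
    A.RightDvd D := by
  obtain ⟨U, rfl⟩ := h
  obtain ⟨V, rfl⟩ := h'
  exact ⟨V * U, (mul_assoc _ _ _).symm⟩

/-- When `G` right-divides `P`, the map given on the basis is the canonical projection `R / R P → R
/ R G`. -/
theorem quotientMap_toD {P G : SkewPoly σ} (hP : P.Monic) (hG : G.Monic) (h : G.RightDvd P)
    (T : SkewPoly σ) : quotientMap P G (P.toD T) = G.toD T := by
  refine toD_congr hG (h.trans ((toD_eq_zero_iff hP _).1 ?_))
  rw [toD_sub, toD_ofVec_self, sub_self]

/-- The leading terms cancel in `G - S`, a left multiple of `S` of degree less than `deg S`, so it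
vanishes. -/
theorem eq_of_rightDvd_of_natDegree_eq {S G : SkewPoly σ} (hS : S.Monic) (hG : G.Monic)
    (h : S.RightDvd G) (hd : S.natDegree = G.natDegree) : G = S := by
  have h0 : S.toD (G - S) = 0 := by
    rw [toD_sub, (toD_eq_zero_iff hS G).2 h, toD_self hS, sub_zero]
  have hc : ∀ n, S.natDegree ≤ n → (G - S).coeff n = 0 := by
    intro n hn
    rw [coeff_sub]
    rcases hn.eq_or_lt with rfl | hn
    · rw [show S.coeff S.natDegree = 1 from hS, hd, show G.coeff G.natDegree = 1 from hG, sub_self]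
    · rw [coeff_eq_zero_of_natDegree_lt hn, coeff_eq_zero_of_natDegree_lt (hd ▸ hn), sub_zero]
  rw [← sub_eq_zero]
  ext n
  rcases le_or_gt S.natDegree n with hn | hn
  · exact hc n hn
  · rw [← toD_apply_of_coeff_eq_zero S hc ⟨n, hn⟩, h0]
    rfl

theorem X_pow_mul_C (n : ℕ) (a : K) :
    X σ ^ n * C σ a = C σ (σ^[n] a) * X σ ^ n := by
  induction n with
  | zero => simp
  | succ n ih =>
    rw [pow_succ', mul_assoc, ih, ← mul_assoc, X_mul_C, mul_assoc, Function.iterate_succ_apply']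

theorem eq_one_of_natDegree_eq_zero {P : SkewPoly σ} (hP : P.Monic)
    (h : P.natDegree = 0) : P = 1 := by
  ext n
  rw [coeff_one]
  split_ifs with hn
  · rw [hn, ← h]
    exact hP
  · exact coeff_eq_zero_of_natDegree_lt (by omega)

end Module

/-! ### Central elements `Q(X ^ r)` and the polynomial `Ψ` -/

section FiniteField

variable {F K : Type*} [Field F] [Fintype F] [Field K] [Finite K] [Algebra F K]

theorem toD_X_pow_finrank_mul (P A : SkewPoly (frobHom F K)) :
    P.toD (X (frobHom F K) ^ Module.finrank F K * A) = P.phiPow (P.toD A) :=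
  toD_X_pow_mul P _ A

theorem toD_evalXPow_mul (P : SkewPoly (frobHom F K)) (Q : Polynomial F)
    (A : SkewPoly (frobHom F K)) :
    P.toD (evalXPow K Q * A) =
      Polynomial.aeval P.phiPow (Q.map (algebraMap F K)) (P.toD A) := by
  induction Q using Polynomial.induction_on' with
  | add p q hp hq =>
    have h : evalXPow K (p + q) = evalXPow K p + evalXPow K q := Polynomial.eval₂_add _ _
    rw [h, add_mul, toD_add, hp, hq, Polynomial.map_add, map_add, LinearMap.add_apply]
  | monomial n a =>
    rw [evalXPow, Polynomial.eval₂_monomial, mul_assoc, RingHom.comp_apply, toD_C_mul,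
      Polynomial.map_monomial, Polynomial.aeval_monomial, ← Algebra.smul_def,
      LinearMap.smul_apply]
    congr 1
    induction n with
    | zero => simp
    | succ n ih => rw [pow_succ', mul_assoc, toD_X_pow_finrank_mul, ih, pow_succ']; rfl

/-- `Q(X ^ r)` is central. -/
theorem evalXPow_comm (Q : Polynomial F) (A : SkewPoly (frobHom F K)) :
    evalXPow K Q * A = A * evalXPow K Q := by
  have hcomm : ∀ B : SkewPoly (frobHom F K),
      (∀ a : F, Commute B (C (frobHom F K) (algebraMap F K a))) →
      Commute B (X (frobHom F K) ^ Module.finrank F K) → Commute B (evalXPow K Q) := by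
    intro B hC hX
    rw [evalXPow, Polynomial.eval₂_eq_sum_range]
    exact Commute.sum_right _ _ _ fun n _ => (hC _).mul_right (hX.pow_right n)
  -- Constants commute with `X ^ r` because `σ ^ r = id`; `X` commutes with the coefficients of `Q`
  -- because `σ` fixes `F`.
  have hC (b : K) : Commute (C (frobHom F K) b) (evalXPow K Q) := by
    refine hcomm _ (fun a => ?_) ?_
    · exact (Commute.all b (algebraMap F K a)).map (C (frobHom F K))
    · rw [Commute, SemiconjBy, X_pow_mul_C, frobHom_iterate_finrank]
  have hX : Commute (X (frobHom F K)) (evalXPow K Q) := by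
    refine hcomm _ (fun a => ?_) (Commute.self_pow _ _)
    rw [Commute, SemiconjBy, X_mul_C]
    congr 2
    exact (FiniteField.frobeniusAlgHom F K).commutes a
  have h := mul_induction (p := fun B => Commute B (evalXPow K Q)) 1 (Commute.zero_left _)
    (fun _ _ h h' => h.add_left h') (fun a _ h => (hC a).mul_left h)
    (fun _ h => hX.mul_left h) (Commute.one_left _) A
  rw [mul_one] at h
  exact h.eq.symm

theorem Psi_monic (P : SkewPoly (frobHom F K)) : P.Psi.Monic := by
  have h := P.phiPow.charpoly_monic
  rw [← map_Psi] at h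
  exact Polynomial.monic_of_injective (algebraMap F K).injective h

theorem natDegree_Psi (P : SkewPoly (frobHom F K)) : P.Psi.natDegree = P.natDegree := by
  rw [← Polynomial.natDegree_map_eq_of_injective (algebraMap F K).injective, map_Psi,
    LinearMap.charpoly_natDegree, Module.finrank_fin_fun]

/-- The projection `D_P → D_G` is surjective and intertwines the two maps `φ ^ r`, both being
multiplication by `X ^ r`. -/
theorem Psi_dvd_of_rightDvd {P G : SkewPoly (frobHom F K)} (hP : P.Monic) (hG : G.Monic)
    (h : G.RightDvd P) : G.Psi ∣ P.Psi := by
  rw [← Polynomial.map_dvd_map' (algebraMap F K), map_Psi, map_Psi]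
  refine charpoly_dvd_of_surjective _ _ (quotientMap P G) (fun w => ?_) fun v => ?_
  · exact ⟨P.toD (ofVec _ w), by rw [quotientMap_toD hP hG h, toD_ofVec_self]⟩
  · rw [← toD_ofVec_self P v, ← toD_X_pow_finrank_mul, quotientMap_toD hP hG h,
      quotientMap_toD hP hG h, toD_X_pow_finrank_mul]

theorem rightDvd_evalXPow_iff {P : SkewPoly (frobHom F K)} (hP : P.Monic) (Q : Polynomial F) :
    P.RightDvd (evalXPow K Q) ↔
      Polynomial.aeval P.phiPow (Q.map (algebraMap F K)) = 0 := by
  constructor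
  · intro h
    ext1 i
    ext1
    simp only [LinearMap.comp_apply, LinearMap.zero_comp, LinearMap.zero_apply]
    -- Every vector is some `T • e₀`, and centrality turns `Q(X ^ r) T` into `T Q(X ^ r)`, a left
    -- multiple of `P`.
    rw [← toD_ofVec_self P (LinearMap.single K (fun _ => K) i 1), ← toD_evalXPow_mul,
      evalXPow_comm]
    exact toD_mul_eq_zero ((toD_eq_zero_iff hP _).2 h) _
  · intro h
    rw [← toD_eq_zero_iff hP, ← mul_one (evalXPow K Q), toD_evalXPow_mul, h, LinearMap.zero_apply]

/-- `P` right-divides `Ψ(P)(X ^ r)`. -/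
theorem rightDvd_evalXPow_Psi {P : SkewPoly (frobHom F K)} (hP : P.Monic) :
    P.RightDvd (evalXPow K P.Psi) := by
  rw [rightDvd_evalXPow_iff hP, map_Psi]
  exact LinearMap.aeval_self_charpoly _

theorem isCoprime_Psi_of_isUnit {P : SkewPoly (frobHom F K)} {Q : Polynomial F}
    (h : IsUnit (Polynomial.aeval P.phiPow (Q.map (algebraMap F K)))) : IsCoprime Q P.Psi := by
  rw [← Polynomial.isCoprime_map (algebraMap F K), map_Psi]
  exact isCoprime_charpoly_of_isUnit_aeval _ _ h

/-- If `G` right-divides `Q(X ^ r)`, then `Ψ(G)` is coprime to all that is coprime to `Q`. -/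
theorem isCoprime_Psi_of_rightDvd {G : SkewPoly (frobHom F K)} (hG : G.Monic)
    {Q R : Polynomial F} (h : G.RightDvd (evalXPow K Q)) (hR : IsCoprime R Q) :
    IsCoprime R G.Psi := by
  rw [rightDvd_evalXPow_iff hG] at h
  apply isCoprime_Psi_of_isUnit
  -- Evaluating `a R + b Q = 1` at `φ ^ r`, where `Q` vanishes, gives a left inverse of `R(φ ^ r)`;
  -- finite dimension does the rest.
  obtain ⟨a, b, hab⟩ := hR.map (Polynomial.mapRingHom (algebraMap F K))
  have := congrArg (Polynomial.aeval G.phiPow) hab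
  simp only [Polynomial.coe_mapRingHom, map_add, map_mul, h, mul_zero, add_zero, map_one] at this
  have hinj := LinearMap.ker_eq_bot.1 (LinearMap.ker_eq_bot_of_inverse this)
  exact (Module.End.isUnit_iff _).2 ⟨hinj, LinearMap.injective_iff_surjective.1 hinj⟩

/-- If `P` and `Q(X ^ r)` generate the unit left ideal, then `Q` is coprime to `Ψ(P)`. -/
theorem isCoprime_Psi_of_eq_one {P : SkewPoly (frobHom F K)} (hP : P.Monic) {Q : Polynomial F}
    {A B : SkewPoly (frobHom F K)} (h : 1 = A * P + B * evalXPow K Q) : IsCoprime Q P.Psi := by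
  apply isCoprime_Psi_of_isUnit
  have hs : Function.Surjective (Polynomial.aeval P.phiPow (Q.map (algebraMap F K))) := by
    intro v
    -- For `v = T • e₀`, the identity `T = T A P + T B Q(X ^ r)` gives `v = Q(φ ^ r) (T B • e₀)`,
    -- since `P` kills `e₀`.
    refine ⟨P.toD (ofVec _ v * B), ?_⟩
    rw [← toD_evalXPow_mul, evalXPow_comm, mul_assoc]
    conv_rhs => rw [← toD_ofVec_self P v, ← mul_one (ofVec _ v), h, mul_add, toD_add,
      ← mul_assoc, toD_mul_eq_zero (toD_self hP), zero_add]
  exact (Module.End.isUnit_iff _).2 ⟨LinearMap.injective_iff_surjective.2 hs, hs⟩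

end FiniteField

end SkewPoly

/-! ### The proposition -/

theorem mainTheorem11 {F K : Type*} [Field F] [Fintype F] [Field K] [Finite K] [Algebra F K]
    (P : SkewPoly (frobHom F K)) (hP : P.Monic)
    (s : ℕ) (Q : Fin s → Polynomial F) (hQinj : Function.Injective Q)
    (hQmonic : ∀ i, (Q i).Monic) (hQirr : ∀ i, Irreducible (Q i))
    (hPsi : P.Psi = ∏ i, Q i) (i : Fin s) :
    ∃ Pᵢ : SkewPoly (frobHom F K),
      (Pᵢ.Monic ∧ Pᵢ.RightDvd P ∧ Pᵢ.Psi = Q i) ∧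
      (∀ S : SkewPoly (frobHom F K), S.Monic → S.RightDvd P → S.Psi = Q i → S = Pᵢ) ∧
      Pᵢ.IsRgcd P (SkewPoly.evalXPow K (Q i)) := by
  obtain ⟨G, hG, hgcd, A, B, hAB⟩ := SkewPoly.exists_monic_isRgcd hP (SkewPoly.evalXPow K (Q i))
  have hG1 : G.Psi ≠ 1 := by
    intro h1
    have hd : G.natDegree = 0 := by rw [← SkewPoly.natDegree_Psi, h1, Polynomial.natDegree_one]
    rw [SkewPoly.eq_one_of_natDegree_eq_zero hG hd] at hAB
    have hcop := SkewPoly.isCoprime_Psi_of_eq_one hP hAB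
    refine (hQirr i).not_isUnit (hcop.isUnit_of_dvd' dvd_rfl ?_)
    rw [hPsi]
    exact Finset.dvd_prod_of_mem Q (Finset.mem_univ i)
  have hGQ : G.Psi = Q i := by
    refine eq_of_dvd_prod_of_isCoprime Q hQmonic hQirr i _ G.Psi_monic hG1 ?_ fun j hj => ?_
    · rw [← hPsi]
      exact SkewPoly.Psi_dvd_of_rightDvd hP hG hgcd.1
    · refine SkewPoly.isCoprime_Psi_of_rightDvd hG hgcd.2.1 ?_
      refine (hQirr j).coprime_iff_not_dvd.2 fun hdvd => hj (hQinj ?_)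
      exact Polynomial.eq_of_monic_of_associated (hQmonic j) (hQmonic i)
        ((hQirr j).associated_of_dvd (hQirr i) hdvd)
  refine ⟨G, ⟨hG, hgcd.1, hGQ⟩, fun S hS hSP hSQ => ?_, hgcd⟩
  -- By Cayley–Hamilton on `D_S`, `S` right-divides `Ψ(S)(X ^ r) = Q i (X ^ r)`.
  have hSG : S.RightDvd G := hgcd.2.2 S hSP (hSQ ▸ SkewPoly.rightDvd_evalXPow_Psi hS)
  refine (SkewPoly.eq_of_rightDvd_of_natDegree_eq hS hG hSG ?_).symm
  rw [← SkewPoly.natDegree_Psi, ← SkewPoly.natDegree_Psi, hSQ, hGQ]
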